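/- All Hilbert spaces are complex. Let $\mathfrak H$ be a Hilbert space. A linear relation in $\mathfrak H$ is a linear subspace $T\subset\mathfrak H\oplus\mathfrak H$; its adjoint is $T^*=\{\{g,g'\}:(f',g)=(f,g')\text{ for all }\{f,f'\}\in T\}$, operators are identified with their graphs, and $\rho(T)$ is the set of $z\in\mathbb C$ for which $(T-z)^{-1}$ is an everywhere defined bounded operator. A symmetric operator $A$ in $\mathfrak H$ is simple if there is no decomposition $\mathfrak H=\mathfrak H'\oplus\mathfrak H''$, $A=A'\oplus A''$ with $\mathfrak H'\neq\{0\}$, $A'=A'^*$ in $\mathfrak H'$ and $A''$ symmetric in $\mathfrak H''$. Let $A$ be a bounded symmetric operator in $\mathfrak H$ with closed domain $\mathcal D\subset\mathfrak H$, and let $\mathcal H$ be a Hilbert space. A boundary triplet $\Pi=\{\mathcal H\oplus\mathcal H,\Gamma,\Gamma^\top\}$ for the dual pair $\{A,A\}$ consists of surjective linear maps $\Gamma=(\Gamma_0,\Gamma_1)$ and $\Gamma^\top=(\Gamma_0^\top,\Gamma_1^\top)$ from $A^*$ onto $\mathcal H\oplus\mathcal H$ with $$(f',g)-(f,g')=(\Gamma_1\hat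 f,\Gamma_0^\top\hat g)-(\Gamma_0\hat f,\Gamma_1^\top\hat g),\qquad \hat f=\{f,f'\},\ \hat g=\{g,g'\}\in A^*.$$ Put $A_0=\ker\Gamma_0$. The triplet belongs to the class $BT_\infty$ if $A_0$ is a bounded everywhere defined operator in $\mathfrak H$ and $\Gamma_0\{0,n\}=\Gamma_0^\top\{0,n\}$ for all $n\in\mathfrak H\ominus\mathcal D$. Its Weyl function is the function $M_\Pi$ on $\rho(A_0)$, with bounded operators in $\mathcal H$ as values, determined by $\Gamma_1\{f,zf\}=M_\Pi(z)\Gamma_0\{f,zf\}$ for all $f\in\ker(A^*-z)$. **Theorem.** For $j=1,2$ let $A^{(j)}$ be a bounded simple symmetric operator with closed domain in a Hilbert space $\mathfrak H_j$, and let $\Pi_j=\{\mathcal H\oplus\mathcal H,\Gamma^{(j)},\Gamma^{\top(j)}\}$ (with the same $\mathcal H$) be a boundary triplet of class $BT_\infty$ for $\{A^{(j)},A^{(j)}\}$; thus $A_0^{(j)}=\ker\Gamma_0^{(j)}$ is a bounded, not necessarily self-adjoint, operator. If for some $R>0$ $$M_{\Pi_1}(z)=M_{\Pi_2}(z)\qquad\text{for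 all } z\in\rho(A_0^{(1)})\cap\rho(A_0^{(2)})\text{ with }|z|>R,$$ then $\Pi_1$ and $\Pi_2$ are unitarily equivalent: there is a unitary operator $U$ from $\mathfrak H_1$ onto $\mathfrak H_2$ such that, with $\widetilde U=U\oplus U$, one has $\widetilde U A^{(1)*}=A^{(2)*}$ and $\Gamma^{(2)}\widetilde U\hat f=\Gamma^{(1)}\hat f$ for all $\hat f\in A^{(1)*}$. -/

import Mathlib

open scoped InnerProductSpace

noncomputable section

/-! Linear relations in `H` are subspaces of `H × H`; a pair `(f, f')` is written `p = (p.1, p.2)`.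
The adjoint relation of `T` is Mathlib's `Submodule.adjoint T`, i.e. all `(g, g')` with
`(f', g) = (f, g')` for every `(f, f') ∈ T`. The adjoint `A*` of a (not necessarily densely defined)
operator `A` is the relation `A.graph.adjoint`. -/

/-- The resolvent set of a linear relation `T`: the points `z` for which the relation
`(T - z)⁻¹ = {(f' - z f, f) : (f, f') ∈ T}` is (the graph of) an everywhere defined bounded
operator. -/
def relResolventSet {H : Type*} [NormedAddCommGroup H] [InnerProductSpace ℂ H]
    (T : Submodule ℂ (H × H)) : Set ℂ :=
  {z | ∃ S : H →L[ℂ] H, ∀ p : H × H, p ∈ T ↔ p.1 = S (p.2 - z • p.1)}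

/-- The linear relation `T` is the graph of an everywhere defined bounded operator. -/
def IsBoundedOperator {H : Type*} [NormedAddCommGroup H] [InnerProductSpace ℂ H]
    (T : Submodule ℂ (H × H)) : Prop :=
  ∃ S : H →L[ℂ] H, T = LinearMap.graph (S : H →ₗ[ℂ] H)

/-- Symmetric operator: `(A f, g) = (f, A g)` on `dom A`. -/
def IsSymmetricOp {H : Type*} [NormedAddCommGroup H] [InnerProductSpace ℂ H]
    (A : H →ₗ.[ℂ] H) : Prop :=
  A.IsFormalAdjoint A

/-- Simplicity of a symmetric operator: whenever `H = K ⊕ Kᗮ` (with `K` a closed subspace)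
and `A = A₁ ⊕ A₂` with `A₁ = A₁*` in `K` and `A₂` symmetric in `Kᗮ`, the space `K` is trivial. -/
def IsSimpleOp {H : Type*} [NormedAddCommGroup H] [InnerProductSpace ℂ H]
    (A : H →ₗ.[ℂ] H) : Prop :=
  ∀ K : Submodule ℂ H, IsClosed (K : Set H) →
    ∀ (A₁ : K →ₗ.[ℂ] K) (A₂ : Kᗮ →ₗ.[ℂ] Kᗮ),
      A₁.graph = A₁.graph.adjoint → IsSymmetricOp A₂ →
      A.graph = A₁.graph.map (K.subtype.prodMap K.subtype) ⊔
        A₂.graph.map (Kᗮ.subtype.prodMap Kᗮ.subtype) →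
      K = ⊥

/-- A boundary triplet `{G ⊕ G, Γ, Γᵀ}` for the dual pair `{A, A}`: linear mappings
`Γ = (Γ₀, Γ₁)` and `Γᵀ = (Γ₀ᵀ, Γ₁ᵀ)` from `A*` onto `G ⊕ G` such that
`(f', g) - (f, g') = (Γ₁ f̂, Γ₀ᵀ ĝ) - (Γ₀ f̂, Γ₁ᵀ ĝ)` for `f̂ = (f, f')`, `ĝ = (g, g')` in `A*`
(Mathlib's inner product `⟪x, y⟫` is linear in `y`, so `(x, y)` is `⟪y, x⟫`). -/
structure DualBoundaryTriplet {H : Type*} [NormedAddCommGroup H] [InnerProductSpace ℂ H]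
    (A : H →ₗ.[ℂ] H) (G : Type*) [NormedAddCommGroup G] [InnerProductSpace ℂ G] where
  Γ : A.graph.adjoint →ₗ[ℂ] G × G
  ΓT : A.graph.adjoint →ₗ[ℂ] G × G
  surjective_Γ : Function.Surjective Γ
  surjective_ΓT : Function.Surjective ΓT
  green : ∀ f g : A.graph.adjoint,
    ⟪(g : H × H).1, (f : H × H).2⟫_ℂ - ⟪(g : H × H).2, (f : H × H).1⟫_ℂ =
      ⟪(ΓT g).1, (Γ f).2⟫_ℂ - ⟪(ΓT g).2, (Γ f).1⟫_ℂ

namespace DualBoundaryTriplet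

variable {H : Type*} [NormedAddCommGroup H] [InnerProductSpace ℂ H]
  {A : H →ₗ.[ℂ] H} {G : Type*} [NormedAddCommGroup G] [InnerProductSpace ℂ G]

/-- The component `Γ₀`. -/
def Γ₀ (P : DualBoundaryTriplet A G) : A.graph.adjoint →ₗ[ℂ] G := LinearMap.fst ℂ G G ∘ₗ P.Γ

/-- The component `Γ₁`. -/
def Γ₁ (P : DualBoundaryTriplet A G) : A.graph.adjoint →ₗ[ℂ] G := LinearMap.snd ℂ G G ∘ₗ P.Γ

/-- The component `Γ₀ᵀ`. -/
def Γ₀T (P : DualBoundaryTriplet A G) : A.graph.adjoint →ₗ[ℂ] G := LinearMap.fst ℂ G G ∘ₗ P.ΓT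

/-- The extension `A₀ = ker Γ₀`, a linear relation in `H`. -/
def A₀ (P : DualBoundaryTriplet A G) : Submodule ℂ (H × H) :=
  (LinearMap.ker P.Γ₀).map A.graph.adjoint.subtype

end DualBoundaryTriplet

/-- `{0} ⊕ (dom A)ᗮ` is contained in `A*`. -/
theorem zero_prod_mem_adjoint {H : Type*} [NormedAddCommGroup H] [InnerProductSpace ℂ H]
    (A : H →ₗ.[ℂ] H) {n : H} (hn : n ∈ A.domainᗮ) : ((0, n) : H × H) ∈ A.graph.adjoint := by
  rw [Submodule.mem_adjoint_iff]
  intro a b hab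
  have ha : a ∈ A.domain := LinearPMap.mem_domain_of_mem_graph hab
  simp [Submodule.inner_right_of_mem_orthogonal ha hn]

/-- The class `BT_∞`: `A₀` is a bounded everywhere defined operator and
`Γ₀ (0, n) = Γ₀ᵀ (0, n)` for all `n ∈ H ⊖ dom A`. -/
def DualBoundaryTriplet.IsBTInfty {H : Type*} [NormedAddCommGroup H] [InnerProductSpace ℂ H]
    {A : H →ₗ.[ℂ] H} {G : Type*} [NormedAddCommGroup G] [InnerProductSpace ℂ G]
    (P : DualBoundaryTriplet A G) : Prop :=
  IsBoundedOperator P.A₀ ∧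
    ∀ (n : H) (hn : n ∈ A.domainᗮ),
      P.Γ₀ ⟨(0, n), zero_prod_mem_adjoint A hn⟩ = P.Γ₀T ⟨(0, n), zero_prod_mem_adjoint A hn⟩

/-- The subspace `{(f, z f) : f ∈ ker (A* - z)}` of `A*`. -/
def defectSubspace {H : Type*} [NormedAddCommGroup H] [InnerProductSpace ℂ H]
    (A : H →ₗ.[ℂ] H) (z : ℂ) : Submodule ℂ A.graph.adjoint where
  carrier := {p | (p : H × H).2 = z • (p : H × H).1}
  add_mem' := by
    intro a b ha hb
    simp only [Set.mem_ofPred_eq, Submodule.coe_add, Prod.snd_add, Prod.fst_add] at *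
    rw [ha, hb, smul_add]
  zero_mem' := by simp
  smul_mem' := by
    intro c a ha
    simp only [Set.mem_ofPred_eq, Submodule.coe_smul, Prod.smul_snd, Prod.smul_fst] at *
    rw [ha, smul_comm]

theorem isClosed_adjoint_relation {H : Type*} [NormedAddCommGroup H] [InnerProductSpace ℂ H]
    (T : Submodule ℂ (H × H)) : IsClosed (T.adjoint : Set (H × H)) := by
  have h : (T.adjoint : Set (H × H)) =
      ⋂ p : T, {x : H × H | ⟪(p : H × H).2, x.1⟫_ℂ - ⟪(p : H × H).1, x.2⟫_ℂ = 0} := by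
    ext x
    simp only [SetLike.mem_coe, Submodule.mem_adjoint_iff, Set.mem_iInter, Set.mem_ofPred_eq]
    exact ⟨fun h p => h _ _ p.2, fun h a b hab => h ⟨(a, b), hab⟩⟩
  rw [h]
  exact isClosed_iInter fun p => isClosed_eq (by fun_prop) continuous_const

theorem isClosed_defectSubspace {H : Type*} [NormedAddCommGroup H] [InnerProductSpace ℂ H]
    (A : H →ₗ.[ℂ] H) (z : ℂ) : IsClosed (defectSubspace A z : Set A.graph.adjoint) := by
  change IsClosed {p : A.graph.adjoint | (p : H × H).2 = z • (p : H × H).1}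
  exact isClosed_eq (by fun_prop) (by fun_prop)

instance completeSpace_adjoint_graph {H : Type*} [NormedAddCommGroup H]
    [InnerProductSpace ℂ H] [CompleteSpace H] (A : H →ₗ.[ℂ] H) : CompleteSpace A.graph.adjoint :=
  (isClosed_adjoint_relation A.graph).completeSpace_coe

instance completeSpace_defectSubspace {H : Type*} [NormedAddCommGroup H]
    [InnerProductSpace ℂ H] [CompleteSpace H] (A : H →ₗ.[ℂ] H) (z : ℂ) : CompleteSpace (defectSubspace A z) :=
  (isClosed_defectSubspace A z).completeSpace_coe

namespace DualBoundaryTriplet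

variable {H : Type*} [NormedAddCommGroup H] [InnerProductSpace ℂ H] [CompleteSpace H]
  {A : H →ₗ.[ℂ] H} {G : Type*} [NormedAddCommGroup G] [InnerProductSpace ℂ G] [CompleteSpace G]

theorem continuous_Γ (P : DualBoundaryTriplet A G) : Continuous P.Γ := by
  refine P.Γ.continuous_of_seq_closed_graph fun u x y hu hTu => ?_
  have key : ∀ c : G × G, ⟪c.1, y.2⟫_ℂ - ⟪c.2, y.1⟫_ℂ =
      ⟪c.1, (P.Γ x).2⟫_ℂ - ⟪c.2, (P.Γ x).1⟫_ℂ := by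
    intro c
    obtain ⟨g, rfl⟩ := P.surjective_ΓT c
    rw [← P.green x g]
    have c1 : Continuous fun w : G × G => ⟪(P.ΓT g).1, w.2⟫_ℂ - ⟪(P.ΓT g).2, w.1⟫_ℂ := by
      fun_prop
    have c2 : Continuous fun f : A.graph.adjoint =>
        ⟪(g : H × H).1, (f : H × H).2⟫_ℂ - ⟪(g : H × H).2, (f : H × H).1⟫_ℂ := by
      fun_prop
    have t1 := (c1.tendsto y).comp hTu
    have t2 := (c2.tendsto x).comp hu
    refine tendsto_nhds_unique t1 (t2.congr fun n => ?_)
    exact P.green (u n) g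
  have h2 : y.2 = (P.Γ x).2 := ext_inner_left ℂ fun v => by simpa using key (v, 0)
  have h1 : y.1 = (P.Γ x).1 := ext_inner_left ℂ fun v => by simpa using key (0, v)
  exact Prod.ext h1 h2

/-- `Γ₀` restricted to the defect subspace, as a bounded operator. -/
def Γ₀Defect (P : DualBoundaryTriplet A G) (z : ℂ) : defectSubspace A z →L[ℂ] G where
  toLinearMap := P.Γ₀ ∘ₗ (defectSubspace A z).subtype
  cont := continuous_fst.comp (P.continuous_Γ.comp continuous_subtype_val)

/-- `Γ₁` restricted to the defect subspace, as a bounded operator. -/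
def Γ₁Defect (P : DualBoundaryTriplet A G) (z : ℂ) : defectSubspace A z →L[ℂ] G where
  toLinearMap := P.Γ₁ ∘ₗ (defectSubspace A z).subtype
  cont := continuous_snd.comp (P.continuous_Γ.comp continuous_subtype_val)

theorem ker_Γ₀Defect (P : DualBoundaryTriplet A G) {z : ℂ} (hz : z ∈ relResolventSet P.A₀) :
    (P.Γ₀Defect z).ker = ⊥ := by
  obtain ⟨S, hS⟩ := hz
  rw [eq_bot_iff]
  intro f hf
  have hmem : ((f : A.graph.adjoint) : H × H) ∈ P.A₀ := ⟨f, hf, rfl⟩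
  have hf2 : ((f : A.graph.adjoint) : H × H).2 = z • ((f : A.graph.adjoint) : H × H).1 := f.2
  have h1 := (hS _).1 hmem
  rw [hf2, sub_self, map_zero] at h1
  rw [h1, smul_zero] at hf2
  rw [Submodule.mem_bot]
  exact Subtype.ext (Subtype.ext (Prod.ext h1 hf2))

theorem range_Γ₀Defect (P : DualBoundaryTriplet A G) {z : ℂ} (hz : z ∈ relResolventSet P.A₀) :
    (P.Γ₀Defect z).range = ⊤ := by
  obtain ⟨S, hS⟩ := hz
  rw [eq_top_iff]
  intro h _
  obtain ⟨u, hu⟩ := P.surjective_Γ (h, 0)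
  obtain ⟨w, hw⟩ : ∃ w : H, w = (u : H × H).2 - z • (u : H × H).1 := ⟨_, rfl⟩
  have hv : ((S w, w + z • S w) : H × H) ∈ P.A₀ := (hS _).2 (by simp)
  obtain ⟨v, hv0, hv1⟩ := hv
  have e1 : (v : H × H).1 = S w := congrArg Prod.fst hv1
  have e2 : (v : H × H).2 = w + z • S w := congrArg Prod.snd hv1
  have hd : u - v ∈ defectSubspace A z := by
    change ((u - v : A.graph.adjoint) : H × H).2 = z • ((u - v : A.graph.adjoint) : H × H).1
    simp only [Submodule.coe_sub, Prod.snd_sub, Prod.fst_sub, e1, e2, smul_sub, hw]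
    abel
  refine ⟨⟨u - v, hd⟩, ?_⟩
  change P.Γ₀ (u - v) = h
  have hv0' : P.Γ₀ v = 0 := hv0
  rw [map_sub, hv0', sub_zero]
  exact congrArg Prod.fst hu

/-- For `z ∈ ρ(A₀)`, `Γ₀` maps the defect subspace `{(f, z f) : f ∈ ker (A* - z)}`
isomorphically onto `G`. -/
def Γ₀DefectEquiv (P : DualBoundaryTriplet A G) (z : relResolventSet P.A₀) :
    defectSubspace A (z : ℂ) ≃L[ℂ] G :=
  ContinuousLinearEquiv.ofBijective (𝕜 := ℂ) (𝕜' := ℂ) (σ := RingHom.id ℂ) (σ' := RingHom.id ℂ)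
    (E := defectSubspace A (z : ℂ)) (F := G) (P.Γ₀Defect (z : ℂ))
    (P.ker_Γ₀Defect z.2) (P.range_Γ₀Defect z.2)

/-- The Weyl function `M : ρ(A₀) → [G]`,
`M(z) = Γ₁ ∘ (Γ₀ restricted to {(f, z f) : f ∈ ker (A* - z)})⁻¹`. -/
def weylFunction (P : DualBoundaryTriplet A G) (z : relResolventSet P.A₀) : G →L[ℂ] G :=
  (P.Γ₁Defect (z : ℂ)).comp ((P.Γ₀DefectEquiv z).symm : G →L[ℂ] defectSubspace A (z : ℂ))

/-- The defining relation `Γ₁ (f, z f) = M(z) Γ₀ (f, z f)`. -/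
theorem weylFunction_apply (P : DualBoundaryTriplet A G) (z : relResolventSet P.A₀)
    (f : defectSubspace A (z : ℂ)) : P.weylFunction z (P.Γ₀ f) = P.Γ₁ f := by
  have h : (P.Γ₀DefectEquiv z).symm (P.Γ₀ f) = f :=
    (P.Γ₀DefectEquiv z).symm_apply_apply f
  change P.Γ₁Defect (z : ℂ) ((P.Γ₀DefectEquiv z).symm (P.Γ₀ f)) = P.Γ₁ f
  rw [h]
  rfl

end DualBoundaryTriplet

/-- Boundary triplets `P₁`, `P₂` for `{A₁, A₁}`, `{A₂, A₂}` are unitarily equivalent: for some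
unitary `U` from `H₁` onto `H₂` and `Ũ = U ⊕ U` one has `Ũ A₁* = A₂*` and
`Γ⁽²⁾ (Ũ f̂) = Γ⁽¹⁾ f̂` for all `f̂ ∈ A₁*`. -/
def UnitarilyEquivalentTriplets
    {H₁ : Type*} [NormedAddCommGroup H₁] [InnerProductSpace ℂ H₁]
    {H₂ : Type*} [NormedAddCommGroup H₂] [InnerProductSpace ℂ H₂]
    {G : Type*} [NormedAddCommGroup G] [InnerProductSpace ℂ G]
    {A₁ : H₁ →ₗ.[ℂ] H₁} {A₂ : H₂ →ₗ.[ℂ] H₂}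
    (P₁ : DualBoundaryTriplet A₁ G) (P₂ : DualBoundaryTriplet A₂ G) : Prop :=
  ∃ U : H₁ ≃ₗᵢ[ℂ] H₂,
    A₁.graph.adjoint.map
      ((U.toLinearEquiv : H₁ →ₗ[ℂ] H₂).prodMap (U.toLinearEquiv : H₁ →ₗ[ℂ] H₂)) =
        A₂.graph.adjoint ∧
    ∀ (f : A₁.graph.adjoint) (g : A₂.graph.adjoint),
      (g : H₂ × H₂) = (U (f : H₁ × H₁).1, U (f : H₁ × H₁).2) → P₂.Γ g = P₁.Γ f

end

/-! Let `D = dom A` and let `B` be the bounded operator with graph `A₀`. An element of `A*` minus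
the element of `A₀` with the same first entry is some `(0, n)` with `n ⊥ D`, and `Γ₀` maps these
bijectively onto `G`. With `J : G → Dᗮ` the inverse bijection, `A*` consists of the pairs `(f, B f +
J h)`, `Γ₀` of such a pair is `h`, and Green's identity together with `Γ₀ = Γ₀ᵀ` on `{0} ⊕ Dᗮ` makes
`Γ₁` equal to `T h - J* f` (`exists_isModel`). Hence `(B, J, T)` determines `A*` and `Γ`, and `M(z)
= T - J* (z - B)⁻¹ J` (`inner_weylFunction`).

Near infinity `M` determines `T` and the moments `J* Bᵏ J` (`moments_eq_of_resolvent`). Since `B`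
need not be selfadjoint, an argument is needed to pass from moments to the inner products of `Bˡ J
h'` and `Bᵏ J h`. It is that `B - B†` has values in `Dᗮ = ran J`, hence vanishes on `D`, and its
action on `ran J` is fixed by the moments of order 0 and 1 (`inner_pow_eq_of_moments`). So `Bᵏ J h ↦
B'ᵏ J' h` is isometric. By simplicity these vectors span a dense subspace (`denseRange_krylovMap`),
and the resulting unitary carries one model to the other. -/

noncomputable section

open Filter Topology Bornology

/-! ### Moments of a bounded operator and cyclic models. -/

section Moments

variable {H : Type*} [NormedAddCommGroup H] [InnerProductSpace ℂ H]
  {H' : Type*} [NormedAddCommGroup H'] [InnerProductSpace ℂ H']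
  {G : Type*} [NormedAddCommGroup G] [InnerProductSpace ℂ G]

/-- The map `(hₖ)ₖ ↦ ∑ₖ Bᵏ J hₖ`. -/
def krylovMap (B : H →L[ℂ] H) (J : G →ₗ[ℂ] H) : (ℕ →₀ G) →ₗ[ℂ] H :=
  Finsupp.lsum ℂ fun k => ((B ^ k : H →L[ℂ] H) : H →ₗ[ℂ] H) ∘ₗ J

@[simp]
theorem krylovMap_single (B : H →L[ℂ] H) (J : G →ₗ[ℂ] H) (k : ℕ) (h : G) :
    krylovMap B J (Finsupp.single k h) = (B ^ k) (J h) := by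
  rw [krylovMap, Finsupp.lsum_single]
  rfl

theorem krylovMap_apply (B : H →L[ℂ] H) (J : G →ₗ[ℂ] H) (x : ℕ →₀ G) :
    krylovMap B J x = x.sum fun k h => (B ^ k) (J h) := rfl

theorem apply_krylovMap_mem_range (B : H →L[ℂ] H) (J : G →ₗ[ℂ] H) (x : ℕ →₀ G) :
    B (krylovMap B J x) ∈ LinearMap.range (krylovMap B J) := by
  rw [krylovMap_apply, Finsupp.sum, map_sum]
  refine Submodule.sum_mem _ fun k _ => ⟨Finsupp.single (k + 1) (x k), ?_⟩
  rw [krylovMap_single, pow_succ']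
  rfl

variable [CompleteSpace H] [CompleteSpace H']

/-- If `B - B†` takes its values in a subspace, then it vanishes on the orthogonal complement. -/
theorem apply_eq_adjoint_apply_of_mem_orthogonal {B : H →L[ℂ] H} {N : Submodule ℂ H}
    (hB : ∀ x, B x - B.adjoint x ∈ N) {y : H} (hy : y ∈ Nᗮ) : B y = B.adjoint y := by
  refine ext_inner_left ℂ fun x => ?_
  have h := Submodule.inner_right_of_mem_orthogonal (hB x) hy
  rw [inner_sub_left, ContinuousLinearMap.adjoint_inner_left] at h
  rw [ContinuousLinearMap.adjoint_inner_right]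
  exact (sub_eq_zero.1 h).symm

/-- Moments determine all the inner products `⟪Bˡ J h', Bᵏ J h⟫` when `B - B†` has its values in
the range of `J`. -/
theorem inner_pow_eq_of_moments {B : H →L[ℂ] H} {J : G →ₗ[ℂ] H} {B' : H' →L[ℂ] H'}
    {J' : G →ₗ[ℂ] H'} [(LinearMap.range J).HasOrthogonalProjection]
    [(LinearMap.range J').HasOrthogonalProjection]
    (hB : ∀ x, B x - B.adjoint x ∈ LinearMap.range J)
    (hB' : ∀ x, B' x - B'.adjoint x ∈ LinearMap.range J')
    (hm : ∀ (k : ℕ) (h' h : G), ⟪J h', (B ^ k) (J h)⟫_ℂ = ⟪J' h', (B' ^ k) (J' h)⟫_ℂ)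
    (l k : ℕ) (h' h : G) :
    ⟪(B ^ l) (J h'), (B ^ k) (J h)⟫_ℂ = ⟪(B' ^ l) (J' h'), (B' ^ k) (J' h)⟫_ℂ := by
  have h0 : ∀ h' h, ⟪J h', J h⟫_ℂ = ⟪J' h', J' h⟫_ℂ := by simpa using hm 0
  have h1 : ∀ h' h, ⟪J h', B (J h)⟫_ℂ = ⟪J' h', B' (J' h)⟫_ℂ := by simpa using hm 1
  have hJ : ∀ a b, J' a = J' b → J a = J b := by
    intro a b hab
    rw [← sub_eq_zero, ← map_sub, ← inner_self_eq_zero (𝕜 := ℂ), h0, map_sub, hab, sub_self,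
      inner_zero_right]
  -- One `q` serves both models: orthogonality to `ran J` is a statement about moments only, so it
  -- transfers from the primed side.
  have hproj : ∀ k h, ∃ q, (B ^ k) (J h) - J q ∈ (LinearMap.range J)ᗮ ∧
      (B' ^ k) (J' h) - J' q ∈ (LinearMap.range J')ᗮ := by
    intro k h
    obtain ⟨q, hq⟩ := ((LinearMap.range J').orthogonalProjectionOnto ((B' ^ k) (J' h))).2
    have hq' : (B' ^ k) (J' h) - J' q ∈ (LinearMap.range J')ᗮ := by
      rw [hq]
      exact Submodule.sub_starProjection_mem_orthogonal _
    refine ⟨q, ?_, hq'⟩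
    rintro _ ⟨c, rfl⟩
    have := hq' (J' c) ⟨c, rfl⟩
    rw [inner_sub_right, ← hm, ← h0] at this
    rwa [inner_sub_right]
  -- The part of `Bᵏ J h` orthogonal to `ran J` does not contribute to `B - B†`, so only `J q`
  -- matters.
  have hdef : ∀ k h, ∃ s, B ((B ^ k) (J h)) - B.adjoint ((B ^ k) (J h)) = J s ∧
      B' ((B' ^ k) (J' h)) - B'.adjoint ((B' ^ k) (J' h)) = J' s := by
    intro k h
    obtain ⟨q, hq, hq'⟩ := hproj k h
    have e := apply_eq_adjoint_apply_of_mem_orthogonal hB hq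
    have e' := apply_eq_adjoint_apply_of_mem_orthogonal hB' hq'
    rw [map_sub, map_sub, sub_eq_sub_iff_sub_eq_sub] at e e'
    obtain ⟨t, ht⟩ := hB (J q)
    obtain ⟨s, hs⟩ := hB' (J' q)
    -- By `h1`, pairing `(B - B†) J q` with `J c` involves only first moments, so `t` and `s` define
    -- the same vector under `J`.
    have hpair : ∀ c, ⟪J c, J t⟫_ℂ = ⟪J c, J s⟫_ℂ := by
      intro c
      rw [h0 c s, ht, hs, inner_sub_right, inner_sub_right, ContinuousLinearMap.adjoint_inner_right,
        ContinuousLinearMap.adjoint_inner_right, h1, ← inner_conj_symm (B (J c)), h1,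
        inner_conj_symm]
    have hts : J t = J s := by
      rw [← sub_eq_zero, ← inner_self_eq_zero (𝕜 := ℂ), ← map_sub, map_sub, inner_sub_right,
        ← map_sub, hpair, sub_self]
    exact ⟨s, by rw [e, ← ht, hts], by rw [e', ← hs]⟩
  induction l generalizing k h with
  | zero => simpa using hm k h' h
  | succ l ih =>
    obtain ⟨s, hs, hs'⟩ := hdef k h
    -- Move one factor `B` across as `B†` and replace `B†` by `B` minus the defect `J s`; both
    -- resulting terms have the lower left exponent `l`.
    have a : ⟪(B ^ (l + 1)) (J h'), (B ^ k) (J h)⟫_ℂ =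
        ⟪(B ^ l) (J h'), (B ^ (k + 1)) (J h)⟫_ℂ - ⟪(B ^ l) (J h'), (B ^ 0) (J s)⟫_ℂ := by
      rw [← inner_sub_right, pow_succ' B l, pow_succ' B k, pow_zero]
      simp only [mul_apply_eq_comp, one_apply_eq_self, ← hs]
      rw [sub_sub_cancel, ContinuousLinearMap.adjoint_inner_right]
    have a' : ⟪(B' ^ (l + 1)) (J' h'), (B' ^ k) (J' h)⟫_ℂ =
        ⟪(B' ^ l) (J' h'), (B' ^ (k + 1)) (J' h)⟫_ℂ -
          ⟪(B' ^ l) (J' h'), (B' ^ 0) (J' s)⟫_ℂ := by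
      rw [← inner_sub_right, pow_succ' B' l, pow_succ' B' k, pow_zero]
      simp only [mul_apply_eq_comp, one_apply_eq_self, ← hs']
      rw [sub_sub_cancel, ContinuousLinearMap.adjoint_inner_right]
    rw [a, a', ih, ih]

/-- Two cyclic models with the same moments are unitarily equivalent. -/
theorem exists_linearIsometryEquiv_of_moments {B : H →L[ℂ] H} {J : G →ₗ[ℂ] H} {B' : H' →L[ℂ] H'}
    {J' : G →ₗ[ℂ] H'} [(LinearMap.range J).HasOrthogonalProjection]
    [(LinearMap.range J').HasOrthogonalProjection]
    (hB : ∀ x, B x - B.adjoint x ∈ LinearMap.range J)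
    (hB' : ∀ x, B' x - B'.adjoint x ∈ LinearMap.range J')
    (hd : DenseRange (krylovMap B J)) (hd' : DenseRange (krylovMap B' J'))
    (hm : ∀ (k : ℕ) (h' h : G), ⟪J h', (B ^ k) (J h)⟫_ℂ = ⟪J' h', (B' ^ k) (J' h)⟫_ℂ) :
    ∃ U : H ≃ₗᵢ[ℂ] H', (∀ h, U (J h) = J' h) ∧ ∀ x, U (B x) = B' (U x) := by
  have hnorm : ∀ x : ℕ →₀ G, ‖krylovMap B' J' (LinearEquiv.refl ℂ (ℕ →₀ G) x)‖ =
      ‖krylovMap B J x‖ := by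
    intro x
    rw [LinearEquiv.refl_apply, @norm_eq_sqrt_re_inner ℂ, @norm_eq_sqrt_re_inner ℂ]
    simp only [krylovMap_apply, Finsupp.sum, sum_inner, inner_sum]
    simp only [inner_pow_eq_of_moments hB hB' hm]
  obtain ⟨U, hU⟩ : ∃ U : H ≃ₗᵢ[ℂ] H', ∀ x, U (krylovMap B J x) = krylovMap B' J' x :=
    ⟨_, LinearEquiv.extendOfIsometry_eq (LinearEquiv.refl ℂ (ℕ →₀ G)) _ _ hd hd' hnorm⟩
  have hUp : ∀ k h, U ((B ^ k) (J h)) = (B' ^ k) (J' h) := fun k h => by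
    simpa using hU (Finsupp.single k h)
  refine ⟨U, fun h => by simpa using hUp 0 h, ?_⟩
  -- By continuity it suffices to test on the vectors `Bᵏ J h` and their sums, where `B` raises `k`
  -- by one.
  refine hd.induction ?_ (isClosed_eq (by fun_prop) (by fun_prop))
  rintro _ ⟨x, rfl⟩
  rw [krylovMap_apply, Finsupp.sum]
  simp only [map_sum]
  refine Finset.sum_congr rfl fun k _ => ?_
  rw [hUp, ← mul_apply_eq_comp, ← mul_apply_eq_comp, ← pow_succ',
    ← pow_succ', hUp]

/-! ### Recovering moments from the resolvent at infinity. -/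

theorem tendsto_inner_pow_resolvent (B : H →L[ℂ] H) (a b : H) (k : ℕ) :
    Tendsto (fun z : ℂ => ⟪a, (B ^ k) (resolvent B z b)⟫_ℂ) (cobounded ℂ) (𝓝 0) := by
  have hc : Continuous fun S : H →L[ℂ] H => ⟪a, (B ^ k) (S b)⟫_ℂ := by fun_prop
  have h := (hc.tendsto 0).comp (spectrum.resolvent_tendsto_cobounded (𝕜 := ℂ) B)
  rwa [zero_apply, map_zero, inner_zero_right] at h

/-- The space may be trivial, where `‖1‖ = 0`, so this factor stays in the bound. -/
theorem apply_resolvent_of_norm_lt {B : H →L[ℂ] H} {z : ℂ}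
    (hz : ‖B‖ * ‖(1 : H →L[ℂ] H)‖ < ‖z‖) (b : H) :
    B (resolvent B z b) = z • resolvent B z b - b := by
  have hu : IsUnit (algebraMap ℂ (H →L[ℂ] H) z - B) := spectrum.mem_resolventSet_of_norm_lt_mul hz
  have h := congrArg (fun S : H →L[ℂ] H => S b) (Ring.mul_inverse_cancel _ hu)
  simp only [mul_apply_eq_comp, one_apply_eq_self, sub_apply,
    ContinuousLinearMap.algebraMap_apply] at h
  change z • resolvent B z b - B (resolvent B z b) = b at h
  rw [eq_sub_iff_add_eq, ← eq_sub_iff_add_eq', h]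

theorem eventually_norm_lt_cobounded (r : ℝ) : ∀ᶠ z in cobounded ℂ, r < ‖z‖ :=
  tendsto_norm_cobounded_atTop.eventually_gt_atTop r

theorem eventually_inner_pow_succ_resolvent (B : H →L[ℂ] H) (a b : H) (k : ℕ) :
    ∀ᶠ z in cobounded ℂ, ⟪a, (B ^ (k + 1)) (resolvent B z b)⟫_ℂ =
      z * ⟪a, (B ^ k) (resolvent B z b)⟫_ℂ - ⟪a, (B ^ k) b⟫_ℂ := by
  filter_upwards [eventually_norm_lt_cobounded _] with z hz
  rw [pow_succ, mul_apply_eq_comp, apply_resolvent_of_norm_lt hz, map_sub, inner_sub_right,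
    map_smul, inner_smul_right]

/-- The moments can be recovered from the resolvent near infinity. -/
theorem moments_eq_of_resolvent {B : H →L[ℂ] H} {B' : H' →L[ℂ] H'} {a b : H} {a' b' : H'}
    {c c' : ℂ}
    (h : ∀ᶠ z in cobounded ℂ, c - ⟪a, resolvent B z b⟫_ℂ = c' - ⟪a', resolvent B' z b'⟫_ℂ) :
    c = c' ∧ ∀ k : ℕ, ⟪a, (B ^ k) b⟫_ℂ = ⟪a', (B' ^ k) b'⟫_ℂ := by
  -- The resolvent terms tend to zero, so the constants agree as limits and then cancel.
  have const : ∀ {k : ℕ} {d d' : ℂ}, (∀ᶠ z in cobounded ℂ,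
      d - ⟪a, (B ^ k) (resolvent B z b)⟫_ℂ = d' - ⟪a', (B' ^ k) (resolvent B' z b')⟫_ℂ) →
      d = d' ∧ ∀ᶠ z in cobounded ℂ,
        ⟪a, (B ^ k) (resolvent B z b)⟫_ℂ = ⟪a', (B' ^ k) (resolvent B' z b')⟫_ℂ := by
    intro k d d' hd
    have t := (tendsto_inner_pow_resolvent B a b k).const_sub d
    have t' := (tendsto_inner_pow_resolvent B' a' b' k).const_sub d'
    rw [sub_zero] at t t'
    obtain rfl := tendsto_nhds_unique (t.congr' hd) t'
    exact ⟨rfl, hd.mono fun z hz => sub_right_injective hz⟩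
  -- By `B (z - B)⁻¹ = z (z - B)⁻¹ - 1`, multiplying the equality by `z` exposes the `k`-th moment
  -- as the next constant term. This peels off the Laurent coefficients one at a time.
  have step : ∀ k : ℕ, (∀ᶠ z in cobounded ℂ,
      ⟪a, (B ^ k) (resolvent B z b)⟫_ℂ = ⟪a', (B' ^ k) (resolvent B' z b')⟫_ℂ) →
      ⟪a, (B ^ k) b⟫_ℂ = ⟪a', (B' ^ k) b'⟫_ℂ ∧ ∀ᶠ z in cobounded ℂ,
        ⟪a, (B ^ (k + 1)) (resolvent B z b)⟫_ℂ =
          ⟪a', (B' ^ (k + 1)) (resolvent B' z b')⟫_ℂ := by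
    intro k hk
    have := const (k := k + 1) (d := -⟪a, (B ^ k) b⟫_ℂ) (d' := -⟪a', (B' ^ k) b'⟫_ℂ) (by
      filter_upwards [hk, eventually_inner_pow_succ_resolvent B a b k,
        eventually_inner_pow_succ_resolvent B' a' b' k] with z hz e e'
      rw [e, e', hz]
      ring)
    exact ⟨neg_injective this.1, this.2⟩
  obtain ⟨hc, h0⟩ := const (k := 0) (by simpa using h)
  have all : ∀ k : ℕ, ∀ᶠ z in cobounded ℂ,
      ⟪a, (B ^ k) (resolvent B z b)⟫_ℂ = ⟪a', (B' ^ k) (resolvent B' z b')⟫_ℂ := by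
    intro k
    induction k with
    | zero => exact h0
    | succ k ih => exact (step k ih).2
  exact ⟨hc, fun k => (step k (all k)).1⟩

end Moments

/-! ### Simplicity and density of the vectors `Bᵏ J h`. -/

section Simple

variable {H : Type*} [NormedAddCommGroup H] [InnerProductSpace ℂ H] [CompleteSpace H]

/-- A closed subspace of `dom A` reducing a bounded extension `B` of `A`, on which `B` is
symmetric, splits off a selfadjoint part of `A`. -/
theorem eq_bot_of_isSimpleOp {A : H →ₗ.[ℂ] H} (hA : IsSimpleOp A) (hsymm : IsSymmetricOp A)
    {B : H →L[ℂ] H} (hBA : ∀ f : A.domain, B f = A f) {K : Submodule ℂ H}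
    (hKc : IsClosed (K : Set H)) (hKD : K ≤ A.domain) (hK : ∀ x ∈ K, B x ∈ K) : K = ⊥ := by
  have : CompleteSpace K := hKc.completeSpace_coe
  have hsym : ∀ x ∈ A.domain, ∀ y ∈ A.domain, ⟪B x, y⟫_ℂ = ⟪x, B y⟫_ℂ := by
    intro x hx y hy
    have h := hsymm ⟨x, hx⟩ ⟨y, hy⟩
    rw [← hBA, ← hBA] at h
    exact h
  -- Symmetry of `B` on `dom A` turns invariance of `K` into invariance of its complement within
  -- `dom A`.
  have hK' : ∀ x ∈ A.domain, x ∈ Kᗮ → B x ∈ Kᗮ := by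
    intro x hx hxK y hy
    rw [← hsym y (hKD hy) x hx]
    exact hxK _ (hK y hy)
  let A₁ : K →ₗ.[ℂ] K := ((B : H →ₗ[ℂ] H).restrict hK).toPMap ⊤
  let A₂ : Kᗮ →ₗ.[ℂ] Kᗮ :=
    { domain := A.domain.comap Kᗮ.subtype
      toFun := ((B : H →ₗ[ℂ] H) ∘ₗ Kᗮ.subtype ∘ₗ
        (A.domain.comap Kᗮ.subtype).subtype).codRestrict Kᗮ fun x => hK' _ x.2 x.1.2 }
  have h1 : ∀ p : K × K, p ∈ A₁.graph ↔ B p.1 = p.2 := by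
    intro p
    rw [LinearPMap.mem_graph_iff]
    constructor
    · rintro ⟨y, hy, hy'⟩
      rw [← hy, ← hy']
      rfl
    · intro h
      exact ⟨⟨p.1, trivial⟩, rfl, Subtype.ext h⟩
  have h2 : ∀ p : Kᗮ × Kᗮ, p ∈ A₂.graph ↔ (p.1 : H) ∈ A.domain ∧ B p.1 = p.2 := by
    intro p
    rw [LinearPMap.mem_graph_iff]
    constructor
    · rintro ⟨y, hy, hy'⟩
      rw [← hy, ← hy']
      exact ⟨y.2, rfl⟩
    · intro h
      exact ⟨⟨p.1, h.1⟩, rfl, Subtype.ext h.2⟩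
  refine hA K hKc A₁ A₂ ?_ ?_ ?_
  · ext p
    rw [h1, Submodule.mem_adjoint_iff]
    constructor
    · intro h a b hab
      rw [h1] at hab
      rw [Submodule.coe_inner, Submodule.coe_inner, ← h, ← hab]
      exact sub_eq_zero.2 (hsym _ (hKD a.2) _ (hKD p.1.2))
    · intro h
      have hp : (⟨B p.1, hK _ p.1.2⟩ : K) = p.2 := by
        refine ext_inner_left ℂ fun v => ?_
        have hv := h v ⟨B v, hK _ v.2⟩ ((h1 _).2 rfl)
        rw [← sub_eq_zero.1 hv]
        exact (hsym _ (hKD v.2) _ (hKD p.1.2)).symm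
      exact congrArg Subtype.val hp
  · intro x y
    exact hsym _ x.2 _ y.2
  · ext p
    rw [Submodule.mem_sup, LinearPMap.mem_graph_iff]
    constructor
    · rintro ⟨y, hy, hy'⟩
      -- Since `K ≤ dom A`, both orthogonal components of a vector of `dom A` stay in `dom A`.
      obtain ⟨k, hk, l, hl, hkl⟩ := K.exists_add_mem_mem_orthogonal (y : H)
      have hlD : l ∈ A.domain := by
        have : l = y - k := by rw [hkl, add_sub_cancel_left]
        rw [this]
        exact A.domain.sub_mem y.2 (hKD hk)
      refine ⟨(k, B k), ⟨(⟨k, hk⟩, ⟨B k, hK k hk⟩), (h1 _).2 rfl, rfl⟩, (l, B l),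
        ⟨(⟨l, hl⟩, ⟨B l, hK' l hlD hl⟩), (h2 _).2 ⟨hlD, rfl⟩, rfl⟩, ?_⟩
      refine Prod.ext ?_ ?_
      · rw [← hy, hkl]
        rfl
      · rw [← hy', ← hBA, hkl, map_add]
        rfl
    · rintro ⟨_, ⟨a, ha, rfl⟩, _, ⟨b, hb, rfl⟩, rfl⟩
      have ha' := (h1 a).1 ha
      obtain ⟨hbD, hb'⟩ := (h2 b).1 hb
      refine ⟨⟨(a.1 : H) + b.1, A.domain.add_mem (hKD a.1.2) hbD⟩, rfl, ?_⟩
      rw [← hBA]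
      change B ((a.1 : H) + b.1) = a.2 + b.2
      rw [map_add, ha', hb']

/-- For a simple operator `A` the vectors `Bᵏ n` with `n ⊥ dom A` span a dense subspace. -/
theorem denseRange_krylovMap {G : Type*} [NormedAddCommGroup G] [InnerProductSpace ℂ G]
    {A : H →ₗ.[ℂ] H} (hdom : IsClosed (A.domain : Set H)) (hA : IsSimpleOp A)
    (hsymm : IsSymmetricOp A) {B : H →L[ℂ] H} (hBA : ∀ f : A.domain, B f = A f)
    (hB : ∀ x, B x - B.adjoint x ∈ A.domainᗮ) {J : G →ₗ[ℂ] H}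
    (hJ : LinearMap.range J = A.domainᗮ) : DenseRange (krylovMap B J) := by
  have : CompleteSpace A.domain := hdom.completeSpace_coe
  have hle : A.domainᗮ ≤ LinearMap.range (krylovMap B J) := by
    rw [← hJ]
    rintro _ ⟨h, rfl⟩
    exact ⟨Finsupp.single 0 h, by rw [krylovMap_single]; rfl⟩
  -- The complement is orthogonal to `(dom A)ᗮ`, hence lies in the closed subspace `dom A`. There `B
  -- = B†`, and `B†` preserves the complement of a `B`-invariant subspace.
  have hbot : (LinearMap.range (krylovMap B J))ᗮ = ⊥ := by
    refine eq_bot_of_isSimpleOp hA hsymm hBA (Submodule.isClosed_orthogonal _) ?_ ?_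
    · rw [← Submodule.orthogonal_orthogonal A.domain]
      exact Submodule.orthogonal_le hle
    · intro x hx
      rw [apply_eq_adjoint_apply_of_mem_orthogonal hB (Submodule.orthogonal_le hle hx)]
      rintro _ ⟨y, rfl⟩
      rw [ContinuousLinearMap.adjoint_inner_right]
      exact hx _ (apply_krylovMap_mem_range B J y)
  have := Submodule.topologicalClosure_eq_top_iff.2 hbot
  rw [← Submodule.dense_iff_topologicalClosure_eq_top] at this
  exact this

end Simple

/-! ### The model of a triplet of class `BT_∞` and its Weyl function. -/

namespace DualBoundaryTriplet

variable {H : Type*} [NormedAddCommGroup H] [InnerProductSpace ℂ H]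
  {A : H →ₗ.[ℂ] H} {G : Type*} [NormedAddCommGroup G] [InnerProductSpace ℂ G]

/-- For `f̂` in the graph of `A` the left side of Green's identity vanishes against all of `A*`;
surjectivity of `Γᵀ` then forces `Γ₀ f̂ = 0`. -/
theorem graph_le_A₀ (P : DualBoundaryTriplet A G) (hsymm : IsSymmetricOp A) (f : A.domain) :
    ((f : H), A f) ∈ P.A₀ := by
  have hf : ((f : H), A f) ∈ A.graph.adjoint := by
    rw [Submodule.mem_adjoint_iff]
    intro a b hab
    obtain ⟨y, rfl, rfl⟩ := (LinearPMap.mem_graph_iff A).1 hab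
    exact sub_eq_zero.2 (hsymm y f)
  refine ⟨⟨_, hf⟩, ?_, rfl⟩
  change P.Γ₀ ⟨_, hf⟩ = 0
  have hinner : ∀ v : G, ⟪v, P.Γ₀ ⟨_, hf⟩⟫_ℂ = 0 := by
    intro v
    obtain ⟨g, hg⟩ := P.surjective_ΓT (0, v)
    have h := P.green ⟨_, hf⟩ g
    have hgA := (Submodule.mem_adjoint_iff _ _).1 g.2 _ _ (A.mem_graph f)
    rw [hg, inner_zero_left, zero_sub] at h
    have : ⟪(g : H × H).1, A f⟫_ℂ - ⟪(g : H × H).2, (f : H)⟫_ℂ = 0 := by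
      rw [← inner_conj_symm, ← inner_conj_symm (g : H × H).2, ← map_sub, hgA, map_zero]
    rw [this] at h
    exact neg_eq_zero.1 h.symm
  exact ext_inner_left ℂ fun v => by rw [hinner, inner_zero_right]

/-- The data describing a boundary triplet of class `BT_∞`: `A₀` is the graph of `B`,
`A* = {(f, B f + J h)}`, and on such an element `Γ₀` is `h` and `Γ₁` is `T h - J* f`. -/
structure IsModel (P : DualBoundaryTriplet A G) (B : H →L[ℂ] H) (J : G →ₗ[ℂ] H)
    (T : G →ₗ[ℂ] G) : Prop where
  A₀_eq : P.A₀ = LinearMap.graph (B : H →ₗ[ℂ] H)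
  range_eq : LinearMap.range J = A.domainᗮ
  mem_adjoint : ∀ p : H × H, p ∈ A.graph.adjoint ↔ ∃ h, p.2 = B p.1 + J h
  Γ₀_eq : ∀ (f : A.graph.adjoint) (h : G),
    (f : H × H).2 = B (f : H × H).1 + J h → P.Γ₀ f = h
  inner_Γ₁ : ∀ (f : A.graph.adjoint) (h h' : G), (f : H × H).2 = B (f : H × H).1 + J h →
    ⟪h', P.Γ₁ f⟫_ℂ = ⟪h', T h⟫_ℂ - ⟪J h', (f : H × H).1⟫_ℂ

theorem sub_mem_orthogonal_of_mem_adjoint {x y z : H} (hy : (x, y) ∈ A.graph.adjoint)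
    (hz : (x, z) ∈ A.graph.adjoint) : y - z ∈ A.domainᗮ := by
  intro a ha
  have h1 := (Submodule.mem_adjoint_iff _ _).1 hy _ _ (A.mem_graph ⟨a, ha⟩)
  have h2 := (Submodule.mem_adjoint_iff _ _).1 hz _ _ (A.mem_graph ⟨a, ha⟩)
  rw [inner_sub_right]
  exact sub_eq_zero.2 ((sub_eq_zero.1 h1).symm.trans (sub_eq_zero.1 h2))

theorem IsBTInfty.exists_isModel {P : DualBoundaryTriplet A G} (hP : P.IsBTInfty) :
    ∃ B J T, P.IsModel B J T := by
  obtain ⟨⟨B, hB⟩, hT⟩ := hP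
  have hker : ∀ x, ∃ v : A.graph.adjoint, P.Γ₀ v = 0 ∧ (v : H × H) = (x, B x) := by
    intro x
    have hx : (x, B x) ∈ P.A₀ := by
      rw [hB]
      rfl
    obtain ⟨v, hv, hv'⟩ := hx
    exact ⟨v, hv, hv'⟩
  have hmem : ∀ x, (x, B x) ∈ A.graph.adjoint := fun x => by
    obtain ⟨v, -, hv⟩ := hker x
    exact hv ▸ v.2
  let ι : A.domainᗮ →ₗ[ℂ] A.graph.adjoint :=
    (LinearMap.inr ℂ H H ∘ₗ A.domainᗮ.subtype).codRestrict _ fun n => zero_prod_mem_adjoint A n.2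
  -- Injective because `A₀` is single-valued; surjective because `A₀` is everywhere defined, so any
  -- element of `A*` can be corrected by `ker Γ₀` to have first entry 0.
  have hbij : Function.Bijective (P.Γ₀ ∘ₗ ι) := by
    constructor
    · rw [← LinearMap.ker_eq_bot, eq_bot_iff]
      intro n hn
      have h0 : ((0, (n : H)) : H × H) ∈ P.A₀ := ⟨ι n, hn, rfl⟩
      rw [hB] at h0
      have : (n : H) = B 0 := h0
      rw [map_zero] at this
      exact Subtype.ext this
    · intro h
      obtain ⟨u, hu⟩ := P.surjective_Γ (h, 0)
      obtain ⟨v, hv, hv'⟩ := hker (u : H × H).1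
      refine ⟨⟨_, sub_mem_orthogonal_of_mem_adjoint u.2 (hmem _)⟩, ?_⟩
      have e : ι ⟨_, sub_mem_orthogonal_of_mem_adjoint u.2 (hmem _)⟩ = u - v := by
        refine Subtype.ext ?_
        change ((0, (u : H × H).2 - B (u : H × H).1) : H × H) = (u : H × H) - v
        rw [hv']
        exact Prod.ext (sub_self _).symm rfl
      rw [LinearMap.comp_apply, e, map_sub, hv, sub_zero]
      exact congrArg Prod.fst hu
  let e := LinearEquiv.ofBijective _ hbij
  let J : G →ₗ[ℂ] H := A.domainᗮ.subtype ∘ₗ e.symm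
  have hJ0 : ∀ h, P.Γ₀ (ι (e.symm h)) = h := fun h => e.apply_symm_apply h
  -- This is where `Γ₀ = Γ₀ᵀ` on `{0} ⊕ (dom A)ᗮ` enters: the same `J` inverts both maps.
  have hJT : ∀ h, (P.ΓT (ι (e.symm h))).1 = h := fun h => by
    conv_rhs => rw [← hJ0 h]
    exact (hT _ (e.symm h).2).symm
  have hsplit : ∀ (f : A.graph.adjoint) (h : G), (f : H × H).2 = B (f : H × H).1 + J h →
      ∃ v : A.graph.adjoint, P.Γ₀ v = 0 ∧ (v : H × H) = ((f : H × H).1, B (f : H × H).1) ∧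
        f = v + ι (e.symm h) := by
    intro f h hf
    obtain ⟨v, hv, hv'⟩ := hker (f : H × H).1
    refine ⟨v, hv, hv', Subtype.ext ?_⟩
    change (f : H × H) = (v : H × H) + (0, J h)
    rw [hv']
    exact Prod.ext (add_zero _).symm hf
  refine ⟨B, J, P.Γ₁ ∘ₗ ι ∘ₗ e.symm, hB, ?_, ?_, ?_, ?_⟩
  · rw [LinearMap.range_comp, LinearEquiv.range, Submodule.map_top, Submodule.range_subtype]
  · intro p
    constructor
    · intro hp
      refine ⟨e ⟨_, sub_mem_orthogonal_of_mem_adjoint hp (hmem p.1)⟩, ?_⟩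
      change p.2 = B p.1 + (e.symm (e _) : A.domainᗮ)
      rw [e.symm_apply_apply, add_sub_cancel]
    · rintro ⟨h, hp⟩
      have := A.graph.adjoint.add_mem (hmem p.1) (zero_prod_mem_adjoint A (e.symm h).2)
      rw [Prod.mk_add_mk, add_zero] at this
      change (p.1, B p.1 + J h) ∈ _ at this
      rwa [← hp] at this
  · intro f h hf
    obtain ⟨v, hv, -, rfl⟩ := hsplit f h hf
    rw [map_add, hv, hJ0, zero_add]
  · intro f h h' hf
    obtain ⟨v, hv, hv', hfv⟩ := hsplit f h hf
    -- Testing `v ∈ A₀` against `(0, J h')` gives `Γ₁ v = -J* f` in weak form, with `f` the first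
    -- entry of `v`.
    have hg := P.green v (ι (e.symm h'))
    have hv0 : (P.Γ v).1 = 0 := hv
    have i1 : ((ι (e.symm h') : A.graph.adjoint) : H × H).1 = 0 := rfl
    have i2 : ((ι (e.symm h') : A.graph.adjoint) : H × H).2 = J h' := rfl
    rw [hJT, hv0, inner_zero_right, sub_zero, i1, i2, inner_zero_left, zero_sub, hv'] at hg
    change _ = ⟪h', P.Γ₁ v⟫_ℂ at hg
    conv_lhs => rw [hfv]
    rw [map_add, inner_add_right, ← hg, neg_add_eq_sub]
    rfl

namespace IsModel

variable {P : DualBoundaryTriplet A G} {B : H →L[ℂ] H} {J : G →ₗ[ℂ] H} {T : G →ₗ[ℂ] G}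

theorem apply_domain (h : P.IsModel B J T) (hsymm : IsSymmetricOp A) (f : A.domain) :
    B f = A f := by
  have hf := P.graph_le_A₀ hsymm f
  rw [h.A₀_eq] at hf
  exact ((LinearMap.mem_graph_iff _ _).1 hf).symm

variable [CompleteSpace H]

/-- Both `B` and `B†` have graphs inside `A*`, and two elements of `A*` with equal first entries
differ by a vector of `(dom A)ᗮ`. -/
theorem sub_adjoint_mem (h : P.IsModel B J T) (hsymm : IsSymmetricOp A) (x : H) :
    B x - B.adjoint x ∈ A.domainᗮ := by
  have hx : (x, B x) ∈ A.graph.adjoint := (h.mem_adjoint _).2 ⟨0, by simp⟩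
  intro a ha
  have hxa := (Submodule.mem_adjoint_iff _ _).1 hx _ _ (A.mem_graph ⟨a, ha⟩)
  rw [← h.apply_domain hsymm] at hxa
  rw [inner_sub_right, ContinuousLinearMap.adjoint_inner_right]
  exact sub_eq_zero.2 (sub_eq_zero.1 hxa).symm

theorem mem_relResolventSet (h : P.IsModel B J T) {z : ℂ}
    (hz : ‖B‖ * ‖(1 : H →L[ℂ] H)‖ < ‖z‖) : z ∈ relResolventSet P.A₀ := by
  have hu : IsUnit (algebraMap ℂ (H →L[ℂ] H) z - B) := spectrum.mem_resolventSet_of_norm_lt_mul hz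
  refine ⟨-resolvent B z, fun p => ?_⟩
  rw [h.A₀_eq, LinearMap.mem_graph_iff, neg_apply]
  constructor
  · intro hp
    have e := congrArg (fun S : H →L[ℂ] H => S p.1) (Ring.inverse_mul_cancel _ hu)
    change resolvent B z (z • p.1 - B p.1) = p.1 at e
    rw [hp, ← map_neg, neg_sub]
    exact e.symm
  · intro hp
    have e := apply_resolvent_of_norm_lt hz (p.2 - z • p.1)
    have hp' : resolvent B z (p.2 - z • p.1) = -p.1 := by
      rw [hp, neg_neg, ← hp]
    rw [hp', map_neg, smul_neg, neg_sub_left, neg_inj, sub_add_cancel] at e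
    exact e.symm

/-- The element of `A*` of the form `(f, z f)` with `Γ₀ = y` solves `z f = B f + J y`, so `f = (z -
B)⁻¹ J y`; the formula for `Γ₁` does the rest. -/
theorem inner_weylFunction [CompleteSpace G] (h : P.IsModel B J T) {z : ℂ}
    (hz : ‖B‖ * ‖(1 : H →L[ℂ] H)‖ < ‖z‖) (x y : G) :
    ⟪x, P.weylFunction ⟨z, h.mem_relResolventSet hz⟩ y⟫_ℂ =
      ⟪x, T y⟫_ℂ - ⟪J x, resolvent B z (J y)⟫_ℂ := by
  have hf : z • resolvent B z (J y) = B (resolvent B z (J y)) + J y := by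
    rw [apply_resolvent_of_norm_lt hz, sub_add_cancel]
  let f : A.graph.adjoint := ⟨(resolvent B z (J y), z • resolvent B z (J y)),
    (h.mem_adjoint _).2 ⟨y, hf⟩⟩
  have hw := P.weylFunction_apply ⟨z, h.mem_relResolventSet hz⟩ ⟨f, rfl⟩
  rw [h.Γ₀_eq f y hf] at hw
  rw [hw, h.inner_Γ₁ f y x hf]

end IsModel

end DualBoundaryTriplet

end

/-! ### Unitary equivalence of the two triplets. -/

theorem theorem4p5
    {H₁ : Type*} [NormedAddCommGroup H₁] [InnerProductSpace ℂ H₁] [CompleteSpace H₁]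
    {H₂ : Type*} [NormedAddCommGroup H₂] [InnerProductSpace ℂ H₂] [CompleteSpace H₂]
    {G : Type*} [NormedAddCommGroup G] [InnerProductSpace ℂ G] [CompleteSpace G]
    (A₁ : H₁ →ₗ.[ℂ] H₁) (A₂ : H₂ →ₗ.[ℂ] H₂)
    (hdom₁ : IsClosed (A₁.domain : Set H₁)) (hdom₂ : IsClosed (A₂.domain : Set H₂))
    (hbdd₁ : ∃ C : ℝ, ∀ f : A₁.domain, ‖A₁ f‖ ≤ C * ‖f‖)
    (hbdd₂ : ∃ C : ℝ, ∀ f : A₂.domain, ‖A₂ f‖ ≤ C * ‖f‖)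
    (hsymm₁ : IsSymmetricOp A₁) (hsymm₂ : IsSymmetricOp A₂)
    (hsimple₁ : IsSimpleOp A₁) (hsimple₂ : IsSimpleOp A₂)
    (P₁ : DualBoundaryTriplet A₁ G) (P₂ : DualBoundaryTriplet A₂ G)
    (hP₁ : P₁.IsBTInfty) (hP₂ : P₂.IsBTInfty)
    (R : ℝ) (hR : 0 < R)
    (hM : ∀ (z : ℂ) (hz₁ : z ∈ relResolventSet P₁.A₀) (hz₂ : z ∈ relResolventSet P₂.A₀),
      R < ‖z‖ → P₁.weylFunction ⟨z, hz₁⟩ = P₂.weylFunction ⟨z, hz₂⟩) :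
    UnitarilyEquivalentTriplets P₁ P₂ := by
  obtain ⟨B₁, J₁, T₁, h₁⟩ := hP₁.exists_isModel
  obtain ⟨B₂, J₂, T₂, h₂⟩ := hP₂.exists_isModel
  have key : ∀ x y : G, ⟪x, T₁ y⟫_ℂ = ⟪x, T₂ y⟫_ℂ ∧
      ∀ k : ℕ, ⟪J₁ x, (B₁ ^ k) (J₁ y)⟫_ℂ = ⟪J₂ x, (B₂ ^ k) (J₂ y)⟫_ℂ := by
    intro x y
    apply moments_eq_of_resolvent
    filter_upwards [eventually_norm_lt_cobounded R, eventually_norm_lt_cobounded _,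
      eventually_norm_lt_cobounded _] with z hz hz₁ hz₂
    rw [← h₁.inner_weylFunction hz₁, ← h₂.inner_weylFunction hz₂, hM z _ _ hz]
  -- Completeness of `ran J₁ = (dom A₁)ᗮ` supplies the orthogonal projection used in the moment
  -- argument.
  have hc₁ : CompleteSpace (LinearMap.range J₁) := by
    rw [h₁.range_eq]
    infer_instance
  have hc₂ : CompleteSpace (LinearMap.range J₂) := by
    rw [h₂.range_eq]
    infer_instance
  obtain ⟨U, hUJ, hUB⟩ := exists_linearIsometryEquiv_of_moments
    (fun x => h₁.range_eq ▸ h₁.sub_adjoint_mem hsymm₁ x)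
    (fun x => h₂.range_eq ▸ h₂.sub_adjoint_mem hsymm₂ x)
    (denseRange_krylovMap hdom₁ hsimple₁ hsymm₁ (h₁.apply_domain hsymm₁)
      (h₁.sub_adjoint_mem hsymm₁) h₁.range_eq)
    (denseRange_krylovMap hdom₂ hsimple₂ hsymm₂ (h₂.apply_domain hsymm₂)
      (h₂.sub_adjoint_mem hsymm₂) h₂.range_eq)
    (fun k x y => (key x y).2 k)
  refine ⟨U, ?_, ?_⟩
  · ext p
    rw [h₂.mem_adjoint]
    constructor
    · rintro ⟨q, hq, rfl⟩
      obtain ⟨h, hq⟩ := (h₁.mem_adjoint q).1 hq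
      refine ⟨h, ?_⟩
      change U q.2 = B₂ (U q.1) + J₂ h
      rw [hq, map_add, hUB, hUJ]
    · rintro ⟨h, hp⟩
      refine ⟨(U.symm p.1, U.symm p.2), (h₁.mem_adjoint _).2 ⟨h, U.injective ?_⟩,
        Prod.ext (U.apply_symm_apply _) (U.apply_symm_apply _)⟩
      rw [map_add, hUB, hUJ, U.apply_symm_apply, U.apply_symm_apply, hp]
  · intro f g hg
    obtain ⟨h, hf⟩ := (h₁.mem_adjoint _).1 f.2
    have hg' : (g : H₂ × H₂).2 = B₂ (g : H₂ × H₂).1 + J₂ h := by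
      rw [hg, hf, map_add, hUB, hUJ]
    -- The same `h` parametrizes both elements, so the `Γ₀` agree; for `Γ₁`, `T₁` and `T₂` have
    -- equal matrix elements and `U` preserves the pairing with `J x`.
    refine Prod.ext ((h₂.Γ₀_eq g h hg').trans (h₁.Γ₀_eq f h hf).symm) ?_
    refine ext_inner_left ℂ fun x => (h₂.inner_Γ₁ g h x hg').trans ?_
    refine Eq.trans ?_ (h₁.inner_Γ₁ f h x hf).symm
    rw [hg, ← hUJ, LinearIsometryEquiv.inner_map_map, (key x h).1]
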